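/- Let $n,K,\bar N$ be non-negative integers, $N=K\bar N$, and let $\pmb x_1,\dots,\pmb x_N\in\mathbb R^n$ and $\bar{\pmb y}\in\mathbb R^N$ be arbitrary data. Partition the indices $\{1,\dots,N\}$ into the consecutive blocks $\mathcal C_i=\{(i-1)\bar N+1,\dots,i\bar N\}$, $1\le i\le K$. For $\pmb y\in\mathbb R^N$ and $\pmb\xi=(\pmb\xi_1,\dots,\pmb\xi_N)\in\mathbb R^{Nn}$ with $\pmb\xi_\ell\in\mathbb R^n$, write $A_1\pmb y+A_2\pmb\xi$ for the vector with entries $y_{\ell_1}-y_{\ell_2}+\pmb\xi_{\ell_2}^{\mathsf T}(\pmb x_{\ell_2}-\pmb x_{\ell_1})$, one for every ordered pair $\ell_1\ne\ell_2$. Let $A_3,A_4$ consist of the rows of $A_1,A_2$ for which $\ell_1,\ell_2$ lie in different blocks, put $C=\begin{bmatrix}A_3&A_4\\ I&0\end{bmatrix}$ and $\pmb\eta=(\pmb y,\pmb\xi)$, and let $Q_1$ be the set of all $(\pmb y,\pmb\xi)$ for which the entries of $A_1\pmb y+A_2\pmb\xi$ with $\ell_1,\ell_2$ in the same block are non-negative.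 Let $(\pmb y^*,\pmb\xi^*)$ be the minimizer of $\tfrac12\|\pmb y\|_2^2+\tfrac12\|\pmb\xi\|_2^2$ over the set of optimal solutions of $\min\{\tfrac12\|\pmb y-\bar{\pmb y}\|_2^2: A_1\pmb y+A_2\pmb\xi\ge 0\}$. For $\gamma>0$ let $(\pmb y(\gamma),\pmb\xi(\gamma))$ be the minimizer of $\tfrac12\|\pmb y-\bar{\pmb y}\|_2^2+\tfrac\gamma2\|\pmb\xi\|_2^2$ subject to $A_1\pmb y+A_2\pmb\xi\ge0$, and put $$g_\gamma(\pmb\theta)=\min_{(\pmb y,\pmb\xi)\in Q_1}\Big\{\tfrac12\|\pmb y-\bar{\pmb y}\|_2^2+\tfrac\gamma2\|\pmb\xi\|_2^2-\pmb\theta^{\mathsf T}C\pmb\eta\Big\},\qquad Q_2=\{\pmb\theta:\ \|\pmb\theta\|_2\le B_\theta,\ \pmb\theta\ge0\}.$$ Then there are constants $K_1,K_2>0$, depending only on the data $(n,K,\bar N,\pmb x_1,\dots,\pmb x_N,\bar{\pmb y})$, such that the following holds for all $\gamma>0$ with $\pmb y(\gamma)\ge 0$, all $\delta>0$, and all $B_\theta>0$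 for which some optimal solution of $\max\{g_\gamma(\pmb\theta):\pmb\theta\ge0\}$ has Euclidean norm at most $B_\theta$. If $\pmb\theta_\delta\in Q_2$ satisfies $g_\gamma(\pmb\theta_\delta)\ge g_\gamma(\pmb\theta)-\delta$ for all $\pmb\theta\in Q_2$, and $(\pmb y_\delta,\pmb\xi_\delta)$ is the minimizer in the definition of $g_\gamma(\pmb\theta_\delta)$, then $$\|\pmb\xi_\delta-\pmb\xi^*\|_2\le K_1\sqrt\gamma+K_2\sqrt{\delta/\gamma}.$$ -/

import Mathlib

open scoped Matrix

namespace ConvexRegression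

/-- `a` is a minimizer of `f` over the set `s`. -/
def IsMinimizer {α : Type*} (f : α → ℝ) (s : Set α) (a : α) : Prop :=
  a ∈ s ∧ IsMinOn f s a

/-- Ordered pairs `(ℓ₁, ℓ₂)` with `ℓ₁ ≠ ℓ₂`: the row indices of `A₁` and `A₂`. -/
abbrev Pair (N : ℕ) : Type := {p : Fin N × Fin N // p.1 ≠ p.2}

/-- The primal variables `η = (y, ξ)`, with `y ∈ ℝ^N` and `ξ ∈ ℝ^{Nn}`; the coordinate
`(ℓ, k)` of `ξ` is the `k`-th coordinate of `ξ_ℓ ∈ ℝ^n`. -/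
abbrev Primal (N n : ℕ) : Type :=
  EuclideanSpace ℝ (Fin N) × EuclideanSpace ℝ (Fin N × Fin n)

/-- The row `(ℓ₁, ℓ₂)` of `A₁ y` is `y_{ℓ₁} - y_{ℓ₂}`. -/
def A₁ (N : ℕ) : Matrix (Pair N) (Fin N) ℝ := fun p ℓ =>
  (if ℓ = p.1.1 then 1 else 0) - (if ℓ = p.1.2 then 1 else 0)

/-- The row `(ℓ₁, ℓ₂)` of `A₂ ξ` is `ξ_{ℓ₂}ᵀ (x_{ℓ₂} - x_{ℓ₁})`. -/
def A₂ {N n : ℕ} (x : Fin N → EuclideanSpace ℝ (Fin n)) :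
    Matrix (Pair N) (Fin N × Fin n) ℝ := fun p c =>
  if c.1 = p.1.2 then x p.1.2 c.2 - x p.1.1 c.2 else 0

/-- The vector `A₁ y + A₂ ξ`. -/
def slack {N n : ℕ} (x : Fin N → EuclideanSpace ℝ (Fin n)) (η : Primal N n) : Pair N → ℝ :=
  A₁ N *ᵥ η.1.ofLp + A₂ x *ᵥ η.2.ofLp

/-- The feasible set `A₁ y + A₂ ξ ≥ 0`. -/
def feasible {N n : ℕ} (x : Fin N → EuclideanSpace ℝ (Fin n)) : Set (Primal N n) :=
  {η | 0 ≤ slack x η}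

/-- The set `χ*` of optimal solutions of the least squares problem
`min ½ ‖y - ȳ‖²` subject to `A₁ y + A₂ ξ ≥ 0`. -/
def lsSolutions {N n : ℕ} (x : Fin N → EuclideanSpace ℝ (Fin n))
    (ybar : EuclideanSpace ℝ (Fin N)) : Set (Primal N n) :=
  {η | IsMinimizer (fun ζ : Primal N n => 1 / 2 * ‖ζ.1 - ybar‖ ^ 2) (feasible x) η}

/-- `(y*, ξ*)`: the element of `χ*` that minimizes `½ ‖y‖² + ½ ‖ξ‖²`. -/
def IsMinNormSolution {N n : ℕ} (x : Fin N → EuclideanSpace ℝ (Fin n))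
    (ybar : EuclideanSpace ℝ (Fin N)) (η : Primal N n) : Prop :=
  IsMinimizer (fun ζ : Primal N n => 1 / 2 * ‖ζ.1‖ ^ 2 + 1 / 2 * ‖ζ.2‖ ^ 2)
    (lsSolutions x ybar) η

/-- The regularized objective `½ ‖y - ȳ‖² + (γ/2) ‖ξ‖²`. -/
noncomputable def regObjective {N n : ℕ} (ybar : EuclideanSpace ℝ (Fin N)) (γ : ℝ)
    (η : Primal N n) : ℝ :=
  1 / 2 * ‖η.1 - ybar‖ ^ 2 + γ / 2 * ‖η.2‖ ^ 2

/-- `(y(γ), ξ(γ))`: the minimizer of the regularized objective over the feasible set. -/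
def IsRegSolution {N n : ℕ} (x : Fin N → EuclideanSpace ℝ (Fin n))
    (ybar : EuclideanSpace ℝ (Fin N)) (γ : ℝ) (η : Primal N n) : Prop :=
  IsMinimizer (regObjective ybar γ) (feasible x) η

/- From here on `N = K * M`, where `M` is the common size of the `K` blocks
`C_i = {ℓ | ℓ.divNat = i}` of consecutive indices. -/

/-- Ordered pairs whose entries lie in different blocks. -/
abbrev CrossPair (K M : ℕ) : Type :=
  {p : Fin (K * M) × Fin (K * M) // p.1.divNat ≠ p.2.divNat}

def CrossPair.toPair {K M : ℕ} (p : CrossPair K M) : Pair (K * M) :=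
  ⟨p.1, fun h => p.2 (congrArg Fin.divNat h)⟩

/-- The rows of `A₁` that belong to pairs from different blocks. -/
def A₃ (K M : ℕ) : Matrix (CrossPair K M) (Fin (K * M)) ℝ :=
  (A₁ (K * M)).submatrix CrossPair.toPair id

/-- The rows of `A₂` that belong to pairs from different blocks. -/
def A₄ {K M n : ℕ} (x : Fin (K * M) → EuclideanSpace ℝ (Fin n)) :
    Matrix (CrossPair K M) (Fin (K * M) × Fin n) ℝ :=
  (A₂ x).submatrix CrossPair.toPair id

/-- `C = [A₃ A₄; I 0]`. -/
def C {K M n : ℕ} (x : Fin (K * M) → EuclideanSpace ℝ (Fin n)) :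
    Matrix (CrossPair K M ⊕ Fin (K * M)) (Fin (K * M) ⊕ Fin (K * M) × Fin n) ℝ :=
  Matrix.fromBlocks (A₃ K M) (A₄ x) 1 0

/-- The dual variables, one for every row of `C`. -/
abbrev Dual (K M : ℕ) : Type := EuclideanSpace ℝ (CrossPair K M ⊕ Fin (K * M))

/-- `Q₁`: the constraints of all pairs that lie in one block, that is
`A₁^{ii} y_i + A₂^{ii} ξ_i ≥ 0` for every block `i`. -/
def Q₁ {K M n : ℕ} (x : Fin (K * M) → EuclideanSpace ℝ (Fin n)) : Set (Primal (K * M) n) :=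
  {η | ∀ p : Pair (K * M), p.1.1.divNat = p.1.2.divNat → 0 ≤ slack x η p}

/-- The partial Lagrangian `½ ‖y - ȳ‖² + (γ/2) ‖ξ‖² - θᵀ C η`. -/
noncomputable def lagrangian {K M n : ℕ} (x : Fin (K * M) → EuclideanSpace ℝ (Fin n))
    (ybar : EuclideanSpace ℝ (Fin (K * M))) (γ : ℝ) (θ : Dual K M)
    (η : Primal (K * M) n) : ℝ :=
  regObjective ybar γ η - θ.ofLp ⬝ᵥ (C x *ᵥ Sum.elim η.1.ofLp η.2.ofLp)

/-- The dual function `g_γ(θ)`, the minimum over `Q₁` of the partial Lagrangian. For `γ > 0`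
the partial Lagrangian is bounded below and `0 ∈ Q₁`, so this infimum is a genuine one. -/
noncomputable def dualFunction {K M n : ℕ} (x : Fin (K * M) → EuclideanSpace ℝ (Fin n))
    (ybar : EuclideanSpace ℝ (Fin (K * M))) (γ : ℝ) (θ : Dual K M) : ℝ :=
  sInf (lagrangian x ybar γ θ '' Q₁ x)

/-- `Q₂ = {θ : ‖θ‖ ≤ B_θ, θ ≥ 0}`. -/
def Q₂ (K M : ℕ) (Bθ : ℝ) : Set (Dual K M) := {θ | ‖θ‖ ≤ Bθ ∧ ∀ r, 0 ≤ θ r}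

/-- `B` bounds the norm of some optimal solution of the dual problem `max {g_γ(θ) : θ ≥ 0}`. -/
def IsDualBound {K M n : ℕ} (x : Fin (K * M) → EuclideanSpace ℝ (Fin n))
    (ybar : EuclideanSpace ℝ (Fin (K * M))) (γ Bθ : ℝ) : Prop :=
  ∃ θ₀ ∈ Q₂ K M Bθ, IsMaxOn (dualFunction x ybar γ) {θ | ∀ r, 0 ≤ θ r} θ₀

/-- `θ` is a `δ`-optimal solution of `max {g_γ(θ) : θ ∈ Q₂}`. -/
def IsDeltaOptimal {K M n : ℕ} (x : Fin (K * M) → EuclideanSpace ℝ (Fin n))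
    (ybar : EuclideanSpace ℝ (Fin (K * M))) (γ Bθ δ : ℝ) (θ : Dual K M) : Prop :=
  θ ∈ Q₂ K M Bθ ∧ ∀ θ' ∈ Q₂ K M Bθ, dualFunction x ybar γ θ' - δ ≤ dualFunction x ybar γ θ

end ConvexRegression

/-!
The distance from `ξδ` to `ξ*` is bounded through `ξ(γ)`. Both halves rest on the
Karush–Kuhn–Tucker conditions for a quadratic function on a polyhedron
(`exists_kkt_multipliers`), which follow from Farkas' lemma (`farkas_finset`), and on quadratic
growth of a strongly convex function away from its minimizer over a convex set (`growth_of_isMinOn`).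

*Regularization error.* Since `y*` is the projection of `ȳ`, the squared distance
`d² = ‖y(γ) - y*‖²` is at most `γ (‖ξ*‖² - ‖ξ(γ)‖²)`. The vector `ξ*` has least norm among the `ξ`
that are feasible together with `y*`; the multipliers of this problem give a constant `c` with
`⟪ξ*, ξ - ξ*⟫ ≥ -c ‖y - y*‖` for all feasible `(y, ξ)` (`exists_inner_lower_bound`). Expanding
`‖ξ(γ)‖²` around `ξ*` then yields `‖ξ(γ) - ξ*‖² ≤ 2 c d - d² / γ ≤ c² γ`
(`norm_regSolution_sub_le`).

*Dual error.* The multipliers of the regularized problem that belong to pairs in different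
blocks form, padded by zeros, a dual point at which `g_γ` is at least the optimal value of the
regularized problem (`exists_dual_ge_regObjective`). As `(y(γ), ξ(γ))` is feasible and
`y(γ) ≥ 0`, it is admissible for all dualized constraints, so the partial Lagrangian at `θδ`
exceeds its minimum over `Q₁` by at most `δ` there. By quadratic growth,
`γ / 2 * ‖ξδ - ξ(γ)‖² ≤ δ` (`norm_dual_sub_regSolution_le`).
-/

namespace ConvexRegression

open Filter Topology
open scoped InnerProductSpace

/-! ### Farkas' lemma and multipliers for quadratic programs -/

/-- **Farkas' lemma** for finitely many linear functionals on a real vector space of any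
dimension. In the induction step a vector `v` violating the conclusion without the new functional
`f i` is used to project onto the kernel of `f i`. -/
theorem farkas_finset {ι E : Type*} [AddCommGroup E] [Module ℝ E] (s : Finset ι) :
    ∀ (f : ι → E →ₗ[ℝ] ℝ) (g : E →ₗ[ℝ] ℝ),
      (∀ v, (∀ i ∈ s, 0 ≤ f i v) → 0 ≤ g v) →
      ∃ μ : ι → ℝ, (∀ i, 0 ≤ μ i) ∧ ∀ v, g v = ∑ i ∈ s, μ i * f i v := by
  classical
  induction s using Finset.induction_on with
  | empty =>
    intro f g h
    refine ⟨0, fun _ => le_rfl, fun v => ?_⟩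
    have h1 := h v (by simp)
    have h2 := h (-v) (by simp)
    rw [map_neg] at h2
    simp only [Finset.sum_empty]
    linarith
  | insert i s hi ih =>
    intro f g h
    by_cases hs : ∀ v, (∀ j ∈ s, 0 ≤ f j v) → 0 ≤ g v
    · obtain ⟨μ, hμ, hg⟩ := ih f g hs
      refine ⟨fun j => if j = i then 0 else μ j, fun j => ?_, fun v => ?_⟩
      · dsimp only
        split_ifs
        exacts [le_rfl, hμ j]
      · rw [Finset.sum_insert hi, hg v]
        simp only [if_true, zero_mul, zero_add]
        refine Finset.sum_congr rfl fun j hj => ?_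
        rw [if_neg (ne_of_mem_of_not_mem hj hi)]
    · push Not at hs
      obtain ⟨w, hw, hgw⟩ := hs
      have hfw : f i w < 0 := by
        by_contra! hc
        refine hgw.not_ge (h w fun j hj => ?_)
        rcases Finset.mem_insert.1 hj with rfl | hj
        exacts [hc, hw j hj]
      -- rescaled so that `u ↦ u + f i u • v` projects onto the kernel of `f i`
      set v : E := (-(f i w))⁻¹ • w with hv
      have hpos : 0 < (-(f i w))⁻¹ := inv_pos.2 (by linarith)
      have hfv : f i v = -1 := by
        rw [hv, map_smul, smul_eq_mul, inv_neg, neg_mul, inv_mul_cancel₀ hfw.ne]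
      have hjv : ∀ j ∈ s, 0 ≤ f j v := fun j hj => by
        rw [hv, map_smul, smul_eq_mul]
        exact mul_nonneg hpos.le (hw j hj)
      obtain ⟨μ, hμ, hg⟩ := ih (fun j => f j + f j v • f i) (g + g v • f i) fun u hu => by
        have key : 0 ≤ g (u + f i u • v) := by
          refine h _ fun j hj => ?_
          rcases Finset.mem_insert.1 hj with rfl | hj
          · simp [hfv]
          · have := hu j hj
            simp only [LinearMap.add_apply, LinearMap.smul_apply, smul_eq_mul] at this
            simp only [map_add, map_smul, smul_eq_mul]
            linarith
        simp only [map_add, map_smul, smul_eq_mul] at key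
        simp only [LinearMap.add_apply, LinearMap.smul_apply, smul_eq_mul]
        linarith
      refine ⟨fun j => if j = i then ∑ k ∈ s, μ k * f k v - g v else μ j, fun j => ?_,
        fun u => ?_⟩
      · dsimp only
        split_ifs
        · have hgv : g v ≤ 0 := by
            rw [hv, map_smul, smul_eq_mul]
            exact mul_nonpos_of_nonneg_of_nonpos hpos.le hgw.le
          have := Finset.sum_nonneg fun k hk => mul_nonneg (hμ k) (hjv k hk)
          linarith
        · exact hμ j
      · have hu := hg u
        simp only [LinearMap.add_apply, LinearMap.smul_apply, smul_eq_mul, mul_add,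
          Finset.sum_add_distrib] at hu
        rw [Finset.sum_insert hi]
        dsimp only
        rw [if_pos rfl, sub_mul, Finset.sum_mul]
        have h1 : ∑ j ∈ s, (if j = i then ∑ k ∈ s, μ k * f k v - g v else μ j) * f j u
            = ∑ j ∈ s, μ j * f j u :=
          Finset.sum_congr rfl fun j hj => by rw [if_neg (ne_of_mem_of_not_mem hj hi)]
        have h2 : ∑ j ∈ s, μ j * (f j v * f i u) = ∑ j ∈ s, μ j * f j v * f i u :=
          Finset.sum_congr rfl fun j _ => (mul_assoc _ _ _).symm
        rw [h1, ← h2]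
        linarith

/-- **Karush–Kuhn–Tucker conditions** at a minimizer `x₀`, over the polyhedron
`{x | ∀ i, 0 ≤ a i x + b i}`, of a function `φ` with the exact second order expansion
`φ (x₀ + v) = φ x₀ + D v + q v`, where `q` is homogeneous of degree two. -/
theorem exists_kkt_multipliers {ι E : Type*} [Fintype ι] [AddCommGroup E] [Module ℝ E]
    (a : ι → E →ₗ[ℝ] ℝ) (b : ι → ℝ) (φ : E → ℝ) (D : E →ₗ[ℝ] ℝ) (q : E → ℝ) (x₀ : E)
    (hq : ∀ (t : ℝ) v, q (t • v) = t ^ 2 * q v) (hφ : ∀ v, φ (x₀ + v) = φ x₀ + D v + q v)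
    (hx₀ : ∀ i, 0 ≤ a i x₀ + b i) (hmin : ∀ x, (∀ i, 0 ≤ a i x + b i) → φ x₀ ≤ φ x) :
    ∃ μ : ι → ℝ, (∀ i, 0 ≤ μ i) ∧ (∀ i, μ i * (a i x₀ + b i) = 0) ∧
      ∀ v, D v = ∑ i, μ i * a i v := by
  classical
  obtain ⟨μ, hμ, hD⟩ := farkas_finset {i | a i x₀ + b i = 0} a D fun v hv => by
    -- `v` is a feasible direction, so the one-sided derivative of `φ` along `v` is nonnegative
    have hfeas : ∀ᶠ t : ℝ in 𝓝[>] 0, ∀ i, 0 ≤ a i (x₀ + t • v) + b i := by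
      refine eventually_all.2 fun i => ?_
      rcases (hx₀ i).eq_or_lt with h0 | hlt
      · filter_upwards [self_mem_nhdsWithin] with t ht
        have := mul_nonneg (le_of_lt ht) (hv i (by simp [← h0]))
        rw [map_add, map_smul, smul_eq_mul]
        linarith
      · have hc : Continuous fun t : ℝ => a i x₀ + b i + t * a i v := by fun_prop
        have hev : ∀ᶠ t : ℝ in 𝓝 0, 0 < a i x₀ + b i + t * a i v :=
          hc.continuousAt.eventually (lt_mem_nhds (by simpa using hlt))
        filter_upwards [hev.filter_mono nhdsWithin_le_nhds] with t ht
        rw [map_add, map_smul, smul_eq_mul]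
        linarith
    have hlim : Tendsto (fun t : ℝ => D v + t * q v) (𝓝[>] 0) (𝓝 (D v)) := by
      have hc : Continuous fun t : ℝ => D v + t * q v := by fun_prop
      simpa using (hc.tendsto 0).mono_left nhdsWithin_le_nhds
    refine ge_of_tendsto hlim ?_
    filter_upwards [hfeas, self_mem_nhdsWithin] with t ht htpos
    have h := hmin _ ht
    rw [hφ, hq, map_smul, smul_eq_mul] at h
    refine (mul_nonneg_iff_of_pos_left (Set.mem_Ioi.1 htpos)).1 ?_
    linarith
  refine ⟨fun i => if a i x₀ + b i = 0 then μ i else 0, fun i => ?_, fun i => ?_, fun v => ?_⟩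
  · dsimp only
    split_ifs
    exacts [hμ i, le_rfl]
  · dsimp only
    split_ifs with h
    exacts [by rw [h, mul_zero], zero_mul _]
  · rw [hD, Finset.sum_filter]
    exact Finset.sum_congr rfl fun i _ => by rw [ite_mul, zero_mul]

/-! ### Quadratic growth -/

/-- If `φ` lies below its chord between a minimizer `a` and another point `b` by exactly
`t (1 - t) c`, as quadratic functions do, then `φ` grows by at least `c` from `a` to `b`. -/
theorem growth_of_isMinOn {E : Type*} [AddCommGroup E] [Module ℝ E] {s : Set E}
    (hs : Convex ℝ s) {φ : E → ℝ} {a b : E} {c : ℝ} (ha : IsMinimizer φ s a) (hb : b ∈ s)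
    (hφ : ∀ t : ℝ, φ ((1 - t) • a + t • b) = (1 - t) * φ a + t * φ b - t * (1 - t) * c) :
    φ a + c ≤ φ b := by
  have hlim : Tendsto (fun t : ℝ => φ a + (1 - t) * c) (𝓝[>] 0) (𝓝 (φ a + c)) := by
    have hc : Continuous fun t : ℝ => φ a + (1 - t) * c := by fun_prop
    simpa using (hc.tendsto 0).mono_left nhdsWithin_le_nhds
  refine le_of_tendsto hlim ?_
  filter_upwards [Ioo_mem_nhdsGT (zero_lt_one' ℝ)] with t ht
  have h := isMinOn_iff.1 ha.2 _ (hs ha.1 hb (sub_nonneg.2 ht.2.le) ht.1.le (by ring))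
  rw [hφ] at h
  refine le_of_mul_le_mul_left (a := t) ?_ ht.1
  linarith

theorem norm_sq_combination {F : Type*} [NormedAddCommGroup F] [InnerProductSpace ℝ F]
    (u v : F) (t : ℝ) :
    ‖(1 - t) • u + t • v‖ ^ 2
      = (1 - t) * ‖u‖ ^ 2 + t * ‖v‖ ^ 2 - t * (1 - t) * ‖v - u‖ ^ 2 := by
  rw [norm_add_sq_real, norm_sub_sq_real, norm_smul, norm_smul, real_inner_smul_left,
    real_inner_smul_right, mul_pow, mul_pow, Real.norm_eq_abs, Real.norm_eq_abs, sq_abs, sq_abs,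
    real_inner_comm v u]
  ring

/-! ### The slack vector -/

section Slack

variable {N n : ℕ} (x : Fin N → EuclideanSpace ℝ (Fin n))

/-- The entry of `A₁ y + A₂ ξ` at a pair, as a linear functional of `(y, ξ)`. -/
def slackForm (p : Pair N) : Primal N n →ₗ[ℝ] ℝ where
  toFun η := slack x η p
  map_add' η ζ := by
    simp only [slack, Prod.fst_add, Prod.snd_add, WithLp.ofLp_add, Matrix.mulVec_add,
      Pi.add_apply]
    ring
  map_smul' t η := by
    simp only [slack, Prod.smul_fst, Prod.smul_snd, WithLp.ofLp_smul, Matrix.mulVec_smul,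
      Pi.add_apply, Pi.smul_apply, smul_eq_mul, RingHom.id_apply]
    ring

@[simp]
theorem slackForm_apply (p : Pair N) (η : Primal N n) : slackForm x p η = slack x η p := rfl

theorem mem_feasible_iff {η : Primal N n} : η ∈ feasible x ↔ ∀ p, 0 ≤ slackForm x p η :=
  Iff.rfl

theorem convex_feasible : Convex ℝ (feasible x) := by
  intro η hη ζ hζ s t hs ht _
  rw [mem_feasible_iff] at *
  intro p
  rw [map_add, map_smul, map_smul, smul_eq_mul, smul_eq_mul]
  exact add_nonneg (mul_nonneg hs (hη p)) (mul_nonneg ht (hζ p))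

theorem slack_inl (p : Pair N) (y : EuclideanSpace ℝ (Fin N)) :
    slack x (y, 0) p = y p.1.1 - y p.1.2 := by
  simp [slack, A₁, Matrix.mulVec, dotProduct, sub_mul, Finset.sum_sub_distrib]

theorem slack_inl_le (p : Pair N) (y : EuclideanSpace ℝ (Fin N)) :
    slack x (y, 0) p ≤ 2 * ‖y‖ := by
  have h1 := (Real.norm_eq_abs _ ▸ PiLp.norm_apply_le y p.1.1 : |y p.1.1| ≤ ‖y‖)
  have h2 := (Real.norm_eq_abs _ ▸ PiLp.norm_apply_le y p.1.2 : |y p.1.2| ≤ ‖y‖)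
  rw [slack_inl]
  linarith [le_abs_self (y p.1.1), neg_abs_le (y p.1.2)]

end Slack

/-! ### The regularization error -/

section Regularization

variable {N n : ℕ} {x : Fin N → EuclideanSpace ℝ (Fin n)} {ybar ystar : EuclideanSpace ℝ (Fin N)}
  {ξstar : EuclideanSpace ℝ (Fin N × Fin n)}

/-- The constant is twice the sum of the multipliers of the constraints in the problem of
minimizing `‖ξ‖` subject to the feasibility of `(y*, ξ)`. -/
theorem exists_inner_lower_bound (hstar : IsMinNormSolution x ybar (ystar, ξstar)) :
    ∃ c ≥ 0, ∀ η ∈ feasible x, -(c * ‖η.1 - ystar‖) ≤ ⟪ξstar, η.2 - ξstar⟫_ℝ := by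
  have hsplit : ∀ (p : Pair N) (ζ : Primal N n),
      slackForm x p ζ = slackForm x p (0, ζ.2) + slackForm x p (ζ.1, 0) := fun p ζ => by
    rw [← map_add]
    simp
  have hfeas : ∀ p, 0 ≤ slackForm x p (ystar, ξstar) := hstar.1.1
  obtain ⟨μ, hμ, hcomp, hD⟩ := exists_kkt_multipliers
    (fun p => slackForm x p ∘ₗ LinearMap.inr ℝ (EuclideanSpace ℝ (Fin N)) _)
    (fun p => slackForm x p (ystar, 0)) (fun ξ => 1 / 2 * ‖ξ‖ ^ 2) (innerₗ _ ξstar)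
    (fun v => 1 / 2 * ‖v‖ ^ 2) ξstar
    (fun t v => by
      rw [norm_smul, mul_pow, Real.norm_eq_abs, sq_abs]
      ring)
    (fun v => by
      rw [norm_add_sq_real, innerₗ_apply_apply]
      ring)
    (fun p => by
      simpa [hsplit p (ystar, ξstar)] using hfeas p)
    (fun ξ hξ => by
      have hf : (ystar, ξ) ∈ feasible x := (mem_feasible_iff x).2 fun p => by
        rw [hsplit p (ystar, ξ)]
        exact hξ p
      -- optimality in the least squares problem depends on the component `y` only
      have h := isMinOn_iff.1 hstar.2 (ystar, ξ) ⟨hf, hstar.1.2⟩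
      simpa using h)
  refine ⟨2 * ∑ p, μ p, by positivity [Finset.sum_nonneg fun p (_ : p ∈ Finset.univ) => hμ p],
    fun η hη => ?_⟩
  have h := hD (η.2 - ξstar)
  rw [innerₗ_apply_apply] at h
  rw [h, mul_right_comm, mul_comm, Finset.sum_mul, ← Finset.sum_neg_distrib]
  refine Finset.sum_le_sum fun p _ => ?_
  have hηp : 0 ≤ slackForm x p η := hη p
  have h1 := hcomp p
  have h2 := slack_inl_le x p (η.1 - ystar)
  have h3 : slackForm x p (0, η.2 - ξstar) = slackForm x p η - slackForm x p (ystar, ξstar)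
      - slackForm x p (η.1 - ystar, 0) := by
    rw [← map_sub, ← map_sub]
    congr 1
    ext <;> simp
  simp only [LinearMap.comp_apply, LinearMap.inr_apply] at h1 ⊢
  rw [← hsplit p (ystar, ξstar)] at h1
  have h4 := mul_nonneg (hμ p) hηp
  have h5 := mul_le_mul_of_nonneg_left h2 (hμ p)
  rw [h3, mul_sub, mul_sub, h1]
  simp only [slackForm_apply] at *
  linarith

theorem lsSolution_growth {η ζ : Primal N n} (hη : η ∈ lsSolutions x ybar) (hζ : ζ ∈ feasible x) :
    1 / 2 * ‖η.1 - ybar‖ ^ 2 + 1 / 2 * ‖ζ.1 - η.1‖ ^ 2 ≤ 1 / 2 * ‖ζ.1 - ybar‖ ^ 2 := by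
  refine growth_of_isMinOn (convex_feasible x) hη hζ fun t => ?_
  have h : ((1 - t) • η + t • ζ).1 - ybar = (1 - t) • (η.1 - ybar) + t • (ζ.1 - ybar) := by
    simp only [Prod.fst_add, Prod.smul_fst]
    module
  rw [h, norm_sq_combination, sub_sub_sub_cancel_right]
  ring

theorem norm_regSolution_sub_le {c γ : ℝ} (hc : 0 ≤ c) (hγ : 0 < γ)
    (hstar : IsMinNormSolution x ybar (ystar, ξstar))
    (hinner : ∀ η ∈ feasible x, -(c * ‖η.1 - ystar‖) ≤ ⟪ξstar, η.2 - ξstar⟫_ℝ)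
    {η : Primal N n} (hη : IsRegSolution x ybar γ η) : ‖η.2 - ξstar‖ ≤ c * √γ := by
  have h1 := lsSolution_growth hstar.1 hη.1
  have h2 := isMinOn_iff.1 hη.2 _ hstar.1.1
  have h3 := hinner η hη.1
  have h4 : ‖η.2‖ ^ 2 = ‖ξstar‖ ^ 2 + 2 * ⟪ξstar, η.2 - ξstar⟫_ℝ + ‖η.2 - ξstar‖ ^ 2 := by
    rw [← norm_add_sq_real, add_sub_cancel]
  simp only [regObjective] at h1 h2
  set d := ‖η.1 - ystar‖
  set e := ‖η.2 - ξstar‖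
  have h5 : d ^ 2 ≤ γ * (2 * (c * d) - e ^ 2) := by
    have := mul_le_mul_of_nonneg_left h3 hγ.le
    rw [h4] at h2
    linarith
  have h6 : γ * e ^ 2 ≤ γ * (c ^ 2 * γ) := by nlinarith [sq_nonneg (d - γ * c)]
  refine abs_le_of_sq_le_sq' ?_ (by positivity) |>.2
  rw [mul_pow, Real.sq_sqrt hγ.le]
  exact le_of_mul_le_mul_left h6 hγ

end Regularization

/-! ### The dual error -/

section DualError

variable {K M n : ℕ} {x : Fin (K * M) → EuclideanSpace ℝ (Fin n)}
  {ybar : EuclideanSpace ℝ (Fin (K * M))} {γ : ℝ}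

theorem convex_Q₁ (x : Fin (K * M) → EuclideanSpace ℝ (Fin n)) : Convex ℝ (Q₁ x) := by
  intro η hη ζ hζ s t hs ht _ p hp
  have h1 : 0 ≤ slackForm x p η := hη p hp
  have h2 : 0 ≤ slackForm x p ζ := hζ p hp
  rw [← slackForm_apply, map_add, map_smul, map_smul, smul_eq_mul, smul_eq_mul]
  exact add_nonneg (mul_nonneg hs h1) (mul_nonneg ht h2)

theorem feasible_subset_Q₁ : feasible x ⊆ Q₁ x := fun _ h p _ => h p

theorem C_mulVec_inl (η : Primal (K * M) n) (p : CrossPair K M) :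
    (C x *ᵥ Sum.elim η.1.ofLp η.2.ofLp) (Sum.inl p) = slack x η p.toPair := by
  rw [C, Matrix.fromBlocks_mulVec]
  rfl

theorem C_mulVec_inr (η : Primal (K * M) n) (ℓ : Fin (K * M)) :
    (C x *ᵥ Sum.elim η.1.ofLp η.2.ofLp) (Sum.inr ℓ) = η.1 ℓ := by
  rw [C, Matrix.fromBlocks_mulVec]
  simp

theorem lagrangian_eq (θ : Dual K M) (η : Primal (K * M) n) :
    lagrangian x ybar γ θ η = regObjective ybar γ η
      - (∑ p : CrossPair K M, θ (Sum.inl p) * slackForm x p.toPair η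
        + ∑ ℓ, θ (Sum.inr ℓ) * η.1 ℓ) := by
  simp only [lagrangian, dotProduct, Fintype.sum_sum_type, C_mulVec_inl, C_mulVec_inr,
    slackForm_apply]

theorem regObjective_combination (η ζ : Primal (K * M) n) (t : ℝ) :
    regObjective ybar γ ((1 - t) • η + t • ζ)
      = (1 - t) * regObjective ybar γ η + t * regObjective ybar γ ζ
        - t * (1 - t) * (1 / 2 * ‖ζ.1 - η.1‖ ^ 2 + γ / 2 * ‖ζ.2 - η.2‖ ^ 2) := by
  have h : ((1 - t) • η + t • ζ).1 - ybar = (1 - t) • (η.1 - ybar) + t • (ζ.1 - ybar) := by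
    simp only [Prod.fst_add, Prod.smul_fst]
    module
  rw [regObjective, h, norm_sq_combination, Prod.snd_add, Prod.smul_snd, Prod.smul_snd,
    norm_sq_combination, sub_sub_sub_cancel_right, regObjective, regObjective]
  ring

theorem lagrangian_growth {θ : Dual K M} {η ζ : Primal (K * M) n}
    (hη : IsMinimizer (lagrangian x ybar γ θ) (Q₁ x) η) (hζ : ζ ∈ Q₁ x) :
    lagrangian x ybar γ θ η + (1 / 2 * ‖ζ.1 - η.1‖ ^ 2 + γ / 2 * ‖ζ.2 - η.2‖ ^ 2)
      ≤ lagrangian x ybar γ θ ζ := by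
  refine growth_of_isMinOn (convex_Q₁ x) hη hζ fun t => ?_
  have h1 : ∑ p : CrossPair K M, θ (Sum.inl p) * slackForm x p.toPair ((1 - t) • η + t • ζ)
      = (1 - t) * ∑ p : CrossPair K M, θ (Sum.inl p) * slackForm x p.toPair η
        + t * ∑ p : CrossPair K M, θ (Sum.inl p) * slackForm x p.toPair ζ := by
    rw [Finset.mul_sum, Finset.mul_sum, ← Finset.sum_add_distrib]
    refine Finset.sum_congr rfl fun p _ => ?_
    rw [map_add, map_smul, map_smul, smul_eq_mul, smul_eq_mul]
    ring
  have h2 : ∑ ℓ, θ (Sum.inr ℓ) * ((1 - t) • η + t • ζ).1 ℓ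
      = (1 - t) * ∑ ℓ, θ (Sum.inr ℓ) * η.1 ℓ + t * ∑ ℓ, θ (Sum.inr ℓ) * ζ.1 ℓ := by
    rw [Finset.mul_sum, Finset.mul_sum, ← Finset.sum_add_distrib]
    refine Finset.sum_congr rfl fun ℓ _ => ?_
    simp only [Prod.fst_add, Prod.smul_fst, PiLp.add_apply, PiLp.smul_apply, smul_eq_mul]
    ring
  rw [lagrangian_eq, lagrangian_eq, lagrangian_eq, regObjective_combination, h1, h2]
  ring

/-- Strong duality for the partial Lagrangian: the multipliers of the pairs in different blocks,
with zeros for the rows `y ≥ 0`, attain the regularized optimal value. -/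
theorem exists_dual_ge_regObjective (hγ : 0 < γ) {η : Primal (K * M) n}
    (hη : IsRegSolution x ybar γ η) :
    ∃ θ : Dual K M, (∀ r, 0 ≤ θ r) ∧ regObjective ybar γ η ≤ dualFunction x ybar γ θ := by
  have hexp : ∀ v : Primal (K * M) n, regObjective ybar γ (η + v) = regObjective ybar γ η
      + (⟪η.1 - ybar, v.1⟫_ℝ + γ * ⟪η.2, v.2⟫_ℝ)
      + (1 / 2 * ‖v.1‖ ^ 2 + γ / 2 * ‖v.2‖ ^ 2) := fun v => by
    simp only [regObjective, Prod.fst_add, Prod.snd_add]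
    rw [add_sub_right_comm, norm_add_sq_real, norm_add_sq_real]
    ring
  obtain ⟨μ, hμ, hcomp, hD⟩ := exists_kkt_multipliers (slackForm x) 0 (regObjective ybar γ)
    (innerₗ _ (η.1 - ybar) ∘ₗ LinearMap.fst ℝ _ _
      + γ • (innerₗ _ η.2 ∘ₗ LinearMap.snd ℝ _ _))
    (fun v => 1 / 2 * ‖v.1‖ ^ 2 + γ / 2 * ‖v.2‖ ^ 2) η
    (fun t v => by
      simp only [Prod.smul_fst, Prod.smul_snd, norm_smul, mul_pow, Real.norm_eq_abs, sq_abs]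
      ring)
    hexp
    (fun p => by simpa using! hη.1 p)
    (fun ζ hζ => isMinOn_iff.1 hη.2 ζ fun p => by simpa using! hζ p)
  refine ⟨WithLp.toLp 2 (Sum.elim (fun p => μ p.toPair) fun _ => 0), ?_, ?_⟩
  · rintro (p | ℓ)
    exacts [hμ _, le_rfl]
  refine le_csInf (Set.Nonempty.image _ ⟨η, feasible_subset_Q₁ hη.1⟩) ?_
  rintro _ ⟨ζ, hζ, rfl⟩
  have hgrad := hD (ζ - η)
  have hval := hexp (ζ - η)
  simp only [LinearMap.add_apply, LinearMap.smul_apply, LinearMap.comp_apply,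
    LinearMap.fst_apply, LinearMap.snd_apply, innerₗ_apply_apply, smul_eq_mul] at hgrad
  rw [hgrad, add_sub_cancel] at hval
  have hcs : ∑ p, μ p * slackForm x p (ζ - η) = ∑ p, μ p * slackForm x p ζ :=
    Finset.sum_congr rfl fun p _ => by
      have := hcomp p
      simp only [Pi.zero_apply, add_zero] at this
      rw [map_sub, mul_sub, this, sub_zero]
  -- the terms left out belong to pairs in one block, where `ζ ∈ Q₁` has nonnegative slack
  have hcross : ∑ p : CrossPair K M, μ p.toPair * slackForm x p.toPair ζ
      ≤ ∑ p, μ p * slackForm x p ζ := by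
    have hinj : Function.Injective (CrossPair.toPair : CrossPair K M → Pair (K * M)) :=
      fun p q h => Subtype.ext (congrArg (fun r : Pair (K * M) => r.1) h)
    rw [← Finset.sum_image (f := fun p => μ p * slackForm x p ζ) hinj.injOn]
    refine Finset.sum_le_sum_of_subset_of_nonneg (Finset.subset_univ _) fun p _ hp => ?_
    refine mul_nonneg (hμ p) (hζ p ?_)
    by_contra hne
    exact hp (Finset.mem_image.2 ⟨⟨p.1, hne⟩, Finset.mem_univ _, rfl⟩)
  rw [lagrangian_eq]
  simp only [Sum.elim_inl, Sum.elim_inr, zero_mul, Finset.sum_const_zero, add_zero]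
  rw [hval, hcs]
  have : 0 ≤ 1 / 2 * ‖(ζ - η).1‖ ^ 2 + γ / 2 * ‖(ζ - η).2‖ ^ 2 := by positivity
  linarith

theorem norm_dual_sub_regSolution_le (hγ : 0 < γ) {δ Bθ : ℝ} {η ζ : Primal (K * M) n}
    (hη : IsRegSolution x ybar γ η) (hy : ∀ ℓ, 0 ≤ η.1 ℓ) (hB : IsDualBound x ybar γ Bθ)
    {θ : Dual K M} (hθ : IsDeltaOptimal x ybar γ Bθ δ θ)
    (hζ : IsMinimizer (lagrangian x ybar γ θ) (Q₁ x) ζ) :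
    ‖ζ.2 - η.2‖ ≤ √2 * √(δ / γ) := by
  obtain ⟨θ₀, hθ₀, hmax⟩ := hB
  obtain ⟨θ', hθ', hstrong⟩ := exists_dual_ge_regObjective hγ hη
  have h1 := isMaxOn_iff.1 hmax θ' hθ'
  have h2 := hθ.2 θ₀ hθ₀
  have h3 : dualFunction x ybar γ θ = lagrangian x ybar γ θ ζ :=
    IsLeast.csInf_eq ⟨⟨ζ, hζ.1, rfl⟩, by
      rintro _ ⟨ζ', hζ', rfl⟩
      exact isMinOn_iff.1 hζ.2 ζ' hζ'⟩
  have h4 := lagrangian_growth hζ (feasible_subset_Q₁ hη.1)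
  have h5 : lagrangian x ybar γ θ η ≤ regObjective ybar γ η := by
    rw [lagrangian_eq]
    have hs : 0 ≤ ∑ p : CrossPair K M, θ (Sum.inl p) * slackForm x p.toPair η :=
      Finset.sum_nonneg fun p _ => mul_nonneg (hθ.1.2 _) (hη.1 p.toPair)
    have ht : 0 ≤ ∑ ℓ, θ (Sum.inr ℓ) * η.1 ℓ :=
      Finset.sum_nonneg fun ℓ _ => mul_nonneg (hθ.1.2 _) (hy ℓ)
    linarith
  have h6 : γ / 2 * ‖η.2 - ζ.2‖ ^ 2 ≤ δ := by
    have : 0 ≤ 1 / 2 * ‖η.1 - ζ.1‖ ^ 2 := by positivity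
    linarith
  rw [norm_sub_rev, ← Real.sqrt_mul zero_le_two]
  refine Real.le_sqrt_of_sq_le ?_
  rw [← mul_div_assoc, le_div_iff₀ hγ]
  linarith

end DualError

end ConvexRegression

theorem mainTheorem2 (n K M : ℕ) (x : Fin (K * M) → EuclideanSpace ℝ (Fin n))
    (ybar : EuclideanSpace ℝ (Fin (K * M)))
    (ystar : EuclideanSpace ℝ (Fin (K * M))) (ξstar : EuclideanSpace ℝ (Fin (K * M) × Fin n))
    (hstar : ConvexRegression.IsMinNormSolution x ybar (ystar, ξstar)) :
    ∃ K₁ > 0, ∃ K₂ > 0, ∀ γ > 0, ∀ δ > 0, ∀ Bθ > 0,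
      ∀ (yγ : EuclideanSpace ℝ (Fin (K * M))) (ξγ : EuclideanSpace ℝ (Fin (K * M) × Fin n)),
        ConvexRegression.IsRegSolution x ybar γ (yγ, ξγ) → (∀ ℓ, 0 ≤ yγ ℓ) →
        ConvexRegression.IsDualBound x ybar γ Bθ →
        ∀ θδ : ConvexRegression.Dual K M,
          ConvexRegression.IsDeltaOptimal x ybar γ Bθ δ θδ →
          ∀ (yδ : EuclideanSpace ℝ (Fin (K * M)))
            (ξδ : EuclideanSpace ℝ (Fin (K * M) × Fin n)),
            ConvexRegression.IsMinimizer (ConvexRegression.lagrangian x ybar γ θδ)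
              (ConvexRegression.Q₁ x) (yδ, ξδ) →
            ‖ξδ - ξstar‖ ≤ K₁ * √γ + K₂ * √(δ / γ) := by
  obtain ⟨c, hc, hinner⟩ := ConvexRegression.exists_inner_lower_bound hstar
  -- `c` may vanish, whereas the constant has to be positive
  refine ⟨c + 1, by positivity, √2, by positivity, ?_⟩
  intro γ hγ δ _ Bθ _ yγ ξγ hreg hy hB θδ hθ yδ ξδ hmin
  have h1 := ConvexRegression.norm_regSolution_sub_le hc hγ hstar hinner hreg
  have h2 := ConvexRegression.norm_dual_sub_regSolution_le hγ hreg hy hB hθ hmin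
  have h3 := norm_sub_le_norm_sub_add_norm_sub ξδ ξγ ξstar
  have h4 := Real.sqrt_nonneg γ
  dsimp only at h1 h2
  linarith
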